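/- Let $F_N$ be the free group on $N$ generators, $\partial F_N$ its Gromov boundary (infinite reduced words in a fixed basis and its inverses), and $\partial^2F_N=(\partial F_N)^2\smallsetminus\Delta$, where $\Delta$ is the diagonal. Let $T$ be an $\mathbb R$-tree with a free, minimal action of $F_N$ by isometries with dense orbits. Let $\widehat T=\overline T\cup\partial T$ be the union of the metric completion of $T$ and its Gromov boundary, equipped with the observers' topology, for which the directions (the connected components of the sets $\widehat T\smallsetminus\{P\}$, $P\in\widehat T$) form a sub-basis of open sets. Let $\mathcal Q:\partial F_N\to\widehat T$ be the map that sends $X$ to the limit of $gP$ as $g\in F_N$ tends to $X$, for $P\in T$ (this limit exists, is unique and does not depend on $P$). The dual lamination of $T$ is \[ L(T)=\{(X,Y)\in\partial^2F_N \mid \mathcal Q(X)=\mathcal Q(Y)\}. \] Let $\mu$ be a current carried by $L(T)$, that is, an $F_N$-invariant and flip-invariant Borel measure on $\partial^2F_N$ that is finite on compact sets and satisfies $\mu(\partial^2F_N\smallsetminus L(T))=0$. Then $\mu$ has no atoms: $\mu(\{(X,Y)\})=0$ for every $(X,Y)\in\partial^2F_N$. -/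

import Mathlib

open MeasureTheory Filter
open scoped NNReal Topology

/-! ### The boundary of the free group `F_N` -/

/-- Letters of the alphabet `A ∪ A⁻¹`, where `A = {a_i : i : Fin N}`; `(i, true)` stands for `a_i` and
`(i, false)` for `a_i⁻¹`, as in `FreeGroup`. -/
abbrev Letter (N : ℕ) : Type := Fin N × Bool

/-- The inverse letter. -/
def Letter.inv {N : ℕ} (a : Letter N) : Letter N := (a.1, !a.2)

/-- `∂F_N`: infinite reduced words in `A ∪ A⁻¹`. -/
def FreeBoundary (N : ℕ) : Type := {X : ℕ → Letter N // ∀ n, X (n + 1) ≠ (X n).inv}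

namespace FreeBoundary

variable {N : ℕ}

/-- The topology induced by the product of discrete topologies. -/
instance : TopologicalSpace (FreeBoundary N) :=
  TopologicalSpace.induced Subtype.val
    (@Pi.topologicalSpace ℕ (fun _ => Letter N) (fun _ => ⊥))

/-- The infinite word without its first letter. -/
def tail (X : FreeBoundary N) : FreeBoundary N :=
  ⟨fun n => X.1 (n + 1), fun n => X.2 (n + 1)⟩

/-- The infinite word with the letter `a` put in front of it. -/
def cons (a : Letter N) (X : FreeBoundary N) (h : X.1 0 ≠ a.inv) : FreeBoundary N :=
  ⟨fun n => Nat.casesOn n a X.1, fun n => by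
    cases n with
    | zero => exact h
    | succ n => exact X.2 n⟩

/-- Left multiplication of an infinite reduced word by a letter, followed by reduction. -/
def push (a : Letter N) (X : FreeBoundary N) : FreeBoundary N :=
  if h : X.1 0 = a.inv then X.tail else X.cons a h

theorem inv_inv_letter (a : Letter N) : a.inv.inv = a := by
  simp [Letter.inv]

theorem push_inv_push (a : Letter N) (X : FreeBoundary N) : push a.inv (push a X) = X := by
  by_cases h : X.1 0 = a.inv
  · have h1 : X.tail.1 0 ≠ a.inv.inv := by
      have := X.2 0
      rw [h] at this
      exact this
    have h2 : push a X = X.tail := dif_pos h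
    rw [h2, push, dif_neg h1]
    apply Subtype.ext
    funext n
    cases n with
    | zero => exact h.symm
    | succ n => rfl
  · have h2 : push a X = X.cons a h := dif_neg h
    have h1 : (X.cons a h).1 0 = a.inv.inv := (inv_inv_letter a).symm
    rw [h2, push, dif_pos h1]
    rfl

/-- Left multiplication by the letter `a`, as a permutation of `∂F_N`. -/
def pushEquiv (a : Letter N) : Equiv.Perm (FreeBoundary N) where
  toFun := push a
  invFun := push a.inv
  left_inv := push_inv_push a
  right_inv X := by
    have h := push_inv_push a.inv X
    rwa [inv_inv_letter] at h

/-- The left action of `F_N` on `∂F_N`. -/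
instance : MulAction (FreeGroup (Fin N)) (FreeBoundary N) :=
  MulAction.compHom (FreeBoundary N)
    (FreeGroup.lift fun i : Fin N => pushEquiv ((i, true) : Letter N))

/-- The prefix of length `n` of an infinite word. -/
def initial (X : FreeBoundary N) (n : ℕ) : List (Letter N) := List.ofFn fun i : Fin n => X.1 i

/-- The trace on `F_N` of the neighbourhoods of `X` in `F_N ∪ ∂F_N`: a basis consists of the sets of
all `g` whose reduced word starts with a given prefix of `X`. -/
def endFilter (X : FreeBoundary N) : Filter (FreeGroup (Fin N)) :=
  ⨅ n : ℕ, 𝓟 {g | X.initial n <+: g.toWord}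

end FreeBoundary

/-- The double boundary `∂²F_N`. -/
def DoubleBoundary (N : ℕ) : Type := {p : FreeBoundary N × FreeBoundary N // p.1 ≠ p.2}

namespace DoubleBoundary

variable {N : ℕ}

instance : TopologicalSpace (DoubleBoundary N) :=
  TopologicalSpace.induced Subtype.val inferInstance

instance : MeasurableSpace (DoubleBoundary N) := borel _

instance : BorelSpace (DoubleBoundary N) := ⟨rfl⟩

/-- The diagonal action of `F_N` on `∂²F_N`. -/
instance : SMul (FreeGroup (Fin N)) (DoubleBoundary N) :=
  ⟨fun g p => ⟨(g • p.1.1, g • p.1.2), fun h => p.2 (MulAction.injective g h)⟩⟩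

/-- The flip map `(X, Y) ↦ (Y, X)`. -/
def flip (p : DoubleBoundary N) : DoubleBoundary N := ⟨(p.1.2, p.1.1), fun h => p.2 h.symm⟩

end DoubleBoundary

/-- A current for `F_N`: an `F_N`-invariant and flip-invariant Borel measure on `∂²F_N` which is
finite on compact sets. -/
structure IsCurrent {N : ℕ} (μ : Measure (DoubleBoundary N)) : Prop where
  finite_on_compacts : IsFiniteMeasureOnCompacts μ
  invariant : ∀ (g : FreeGroup (Fin N)) (s : Set (DoubleBoundary N)), MeasurableSet s →
    μ ((fun p => g • p) ⁻¹' s) = μ s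
  flip_invariant : ∀ s : Set (DoubleBoundary N), MeasurableSet s →
    μ (DoubleBoundary.flip ⁻¹' s) = μ s

/-! ### `ℝ`-trees -/

/-- An `ℝ`-tree: a geodesic `0`-hyperbolic metric space. -/
structure IsRTree (T : Type*) [MetricSpace T] : Prop where
  geodesic : ∀ x y : T, ∃ f : ℝ → T, f 0 = x ∧ f (dist x y) = y ∧
    ∀ s ∈ Set.Icc 0 (dist x y), ∀ t ∈ Set.Icc 0 (dist x y), dist (f s) (f t) = |s - t|
  zero_hyperbolic : ∀ x y z w : T,
    dist x y + dist z w ≤ max (dist x z + dist y w) (dist x w + dist y z)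

/-- A subtree of an `ℝ`-tree: a non-empty subset containing the segment between any two of its
points. -/
def IsSubtree {T : Type*} [MetricSpace T] (S : Set T) : Prop :=
  S.Nonempty ∧ ∀ x ∈ S, ∀ y ∈ S, ∀ z : T, dist x z + dist z y = dist x y → z ∈ S

/-- A minimal action: there is no proper invariant subtree. -/
def IsMinimalTreeAction (G T : Type*) [Group G] [MetricSpace T] [MulAction G T] : Prop :=
  ∀ S : Set T, IsSubtree S → (∀ (g : G), ∀ x ∈ S, g • x ∈ S) → S = Set.univ

section Hat

variable (T : Type*) [MetricSpace T]

/-- Geodesic rays in `T`. -/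
def Ray : Type _ := {γ : ℝ≥0 → T // Isometry γ}

/-- Two rays are asymptotic if they stay at bounded distance. -/
instance rayAsymptotic : Setoid (Ray T) where
  r γ δ := ∃ C : ℝ, ∀ t, dist (γ.1 t) (δ.1 t) ≤ C
  iseqv :=
    { refl := fun γ => ⟨0, fun t => by simp⟩
      symm := fun ⟨C, h⟩ => ⟨C, fun t => by rw [dist_comm]; exact h t⟩
      trans := fun ⟨C, h⟩ ⟨D, k⟩ =>
        ⟨C + D, fun t => (dist_triangle _ _ _).trans (add_le_add (h t) (k t))⟩ }

/-- The Gromov boundary `∂T`: rays up to the asymptotic relation. -/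
def TreeBoundary : Type _ := Quotient (rayAsymptotic T)

/-- `T̂`: the union of the metric completion of `T` and of its Gromov boundary. -/
inductive Hat : Type _
  | point (x : UniformSpace.Completion T) : Hat
  | bdry (ξ : TreeBoundary T) : Hat

variable {T}

/-- The Gromov product `(y | z)_o`. -/
noncomputable def gromovProduct {M : Type*} [MetricSpace M] (o y z : M) : ℝ :=
  (dist o y + dist o z - dist y z) / 2

/-- The points `y` of the completion whose Gromov product at `γ 0` with the end of the ray `γ` is
larger than `t` (the Gromov product of `y` with `γ s` is non-decreasing in `s`). -/
def completionShadow (γ : Ray T) (t : ℝ) : Set (UniformSpace.Completion T) :=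
  {y | ∃ s : ℝ≥0, t < gromovProduct ((γ.1 0 : T) : UniformSpace.Completion T) y (γ.1 s : T)}

/-- The basic neighbourhood in `T̂` of the end of the ray `γ`, with parameter `t`. -/
def shadow (γ : Ray T) (t : ℝ) : Set (Hat T) :=
  {p | match p with
    | .point y => y ∈ completionShadow γ t
    | .bdry ξ => ∃ δ : Ray T, Quotient.mk (rayAsymptotic T) δ = ξ ∧
        ∀ᶠ r : ℝ≥0 in atTop, ((δ.1 r : T) : UniformSpace.Completion T) ∈ completionShadow γ t}

/-- The usual topology of `T̂`: the metric topology on the completion, with shadows as neighbourhoods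
of the boundary points. -/
instance : TopologicalSpace (Hat T) :=
  TopologicalSpace.generateFrom
    ({V | ∃ U : Set (UniformSpace.Completion T), IsOpen U ∧ V = Hat.point '' U} ∪
      {V | ∃ (γ : Ray T) (t : ℝ), V = shadow γ t})

/-- A direction at `P` in `T̂`: a connected component of `T̂ ∖ {P}`. -/
def IsDirection (P : Hat T) (D : Set (Hat T)) : Prop :=
  ∃ x : Hat T, x ≠ P ∧ D = connectedComponentIn {P}ᶜ x

variable (T) in
/-- The observers' topology on `T̂`: the directions are a sub-basis of open sets. -/
abbrev obsTopology : TopologicalSpace (Hat T) :=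
  TopologicalSpace.generateFrom {D | ∃ P : Hat T, IsDirection P D}

end Hat

/-! ### The map `Q` and the dual lamination -/

section DualLamination

variable {N : ℕ} {T : Type*} [MetricSpace T] [MulAction (FreeGroup (Fin N)) T]

/-- `Q(X) = p`: some orbit map `F_N → T`, `g ↦ g P`, tends to `p` at `X` in the observers' topology
of `T̂`. For a minimal very small action with dense orbits on an `ℝ`-tree such a limit exists for
every `X`, and it is unique and does not depend on `P`. -/
def IsQImage (X : FreeBoundary N) (p : Hat T) : Prop :=
  ∃ P : T, Tendsto (fun g : FreeGroup (Fin N) => Hat.point ((g • P : T) : UniformSpace.Completion T))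
    X.endFilter (@nhds (Hat T) (obsTopology T) p)

variable (N T) in
/-- The dual lamination `L(T) = {(X, Y) ∈ ∂²F_N : Q(X) = Q(Y)}`. -/
def dualLamination : Set (DoubleBoundary N) :=
  {Z | ∃ p : Hat T, IsQImage Z.1.1 p ∧ IsQImage Z.1.2 p}

end DualLamination

/-! ### Infinite words and the action of the free group on its boundary -/

namespace FreeBoundary

variable {N : ℕ}

/-! An atom can be moved to a periodic one, and a periodic pair cannot lie in `L(T)`. If `(X, Y)` is
an atom with different first letters, its translates by the inverses of the prefixes of `X` all have
the same mass and all lie in the compact set of pairs with different first letters. That set has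
finite measure, so two translates coincide. Hence some translate `W` of the atom is `(v^∞, v^{-∞})`
with `v ≠ 1` (`IsCurrent.exists_periodic_atom`). As the current is carried by `L(T)`, `W` lies in
`L(T)`: some orbit sequences `v^n P` and `v^{-n} P'` have a common limit `p` in the observers'
topology. By freeness `v` has an axis in `T` (`IsRTree.exists_axis_point`). Each axis point `m`
eventually separates the two sequences, which forces `p = m` (`IsRTree.eq_of_tendsto_of_separated`).
Applied to both `m` and `v m`, this is absurd. -/

theorem mk_singleton_smul (a : Letter N) (X : FreeBoundary N) :
    (FreeGroup.mk [a] : FreeGroup (Fin N)) • X = push a X := by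
  obtain ⟨i, b⟩ := a
  change (FreeGroup.lift fun i : Fin N => pushEquiv ((i, true) : Letter N))
    (FreeGroup.mk [(i, b)]) X = _
  cases b
  · simp only [FreeGroup.lift_mk, List.map_cons, List.map_nil, List.prod_cons, List.prod_nil,
      mul_one, cond_false]
    rfl
  · simp only [FreeGroup.lift_mk, List.map_cons, List.map_nil, List.prod_cons, List.prod_nil,
      mul_one, cond_true]
    rfl

theorem mk_cons_smul (a : Letter N) (L : List (Letter N)) (X : FreeBoundary N) :
    (FreeGroup.mk (a :: L) : FreeGroup (Fin N)) • X = push a (FreeGroup.mk L • X) := by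
  rw [← mk_singleton_smul, ← mul_smul, FreeGroup.mul_mk, List.singleton_append]

theorem push_tail (X : FreeBoundary N) : push (X.1 0) X.tail = X := by
  have h : X.tail.1 0 ≠ (X.1 0).inv := X.2 0
  rw [push, dif_neg h]
  apply Subtype.ext
  funext n
  cases n <;> rfl

theorem push_of_ne {a : Letter N} {X : FreeBoundary N} (h : X.1 0 ≠ a.inv) :
    push a X = X.cons a h := dif_neg h

theorem initial_succ (X : FreeBoundary N) (n : ℕ) :
    X.initial (n + 1) = X.1 0 :: X.tail.initial n := by
  simp [initial, List.ofFn_succ, tail]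

@[simp] theorem length_initial (X : FreeBoundary N) (n : ℕ) : (X.initial n).length = n := by
  simp [initial]

/-- The infinite word without its first `n` letters. -/
def shift (n : ℕ) (X : FreeBoundary N) : FreeBoundary N :=
  ⟨fun m => X.1 (n + m), fun m => X.2 (n + m)⟩

theorem initial_add (X : FreeBoundary N) (m n : ℕ) :
    X.initial (m + n) = X.initial m ++ (X.shift m).initial n := by
  simp [initial, shift, List.ofFn_add]

theorem initial_prefix_initial (X : FreeBoundary N) {m n : ℕ} (h : m ≤ n) :
    X.initial m <+: X.initial n := by
  obtain ⟨k, rfl⟩ := Nat.exists_eq_add_of_le h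
  rw [initial_add]
  exact List.prefix_append _ _

/-- The prefix of length `n` of an infinite word, as a group element. -/
def prefixElt (X : FreeBoundary N) (n : ℕ) : FreeGroup (Fin N) := FreeGroup.mk (X.initial n)

theorem prefixElt_smul_shift (n : ℕ) (X : FreeBoundary N) : X.prefixElt n • X.shift n = X := by
  induction n generalizing X with
  | zero =>
    have : X.prefixElt 0 = 1 := by simp [prefixElt, initial, FreeGroup.one_eq_mk]
    rw [this, one_smul]
    apply Subtype.ext
    funext m
    simp [shift]
  | succ n ih =>
    have h : X.shift (n + 1) = X.tail.shift n := by
      apply Subtype.ext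
      funext m
      exact congrArg X.1 (Nat.add_right_comm n 1 m)
    rw [prefixElt, initial_succ, mk_cons_smul, h]
    exact (congrArg _ (ih X.tail)).trans (push_tail X)

theorem prefixElt_inv_smul (n : ℕ) (X : FreeBoundary N) :
    (X.prefixElt n)⁻¹ • X = X.shift n := by
  rw [inv_smul_eq_iff, prefixElt_smul_shift]

theorem prefixElt_add (X : FreeBoundary N) (m n : ℕ) :
    X.prefixElt (m + n) = X.prefixElt m * (X.shift m).prefixElt n := by
  rw [prefixElt, initial_add, ← FreeGroup.mul_mk]; rfl

theorem prefixElt_mul_of_shift_eq {X : FreeBoundary N} {k : ℕ} (h : X.shift k = X) (n : ℕ) :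
    X.prefixElt (k * n) = X.prefixElt k ^ n := by
  induction n with
  | zero => simp [prefixElt, initial, FreeGroup.one_eq_mk]
  | succ n ih => rw [mul_add, mul_one, add_comm, prefixElt_add, h, ih, pow_succ']

theorem ne_inv_iff {a b : Letter N} : b ≠ a.inv ↔ (a.1 = b.1 → a.2 = b.2) := by
  obtain ⟨i, s⟩ := a
  obtain ⟨j, t⟩ := b
  simp only [Letter.inv, ne_eq, Prod.mk.injEq, not_and]
  cases s <;> cases t <;> simp [eq_comm]

theorem isReduced_initial (X : FreeBoundary N) (n : ℕ) : FreeGroup.IsReduced (X.initial n) := by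
  induction n generalizing X with
  | zero => simp [initial]
  | succ n ih =>
    rw [initial_succ]
    cases n with
    | zero => simp [initial]
    | succ n =>
      have h := ih X.tail
      rw [initial_succ] at h ⊢
      rw [FreeGroup.isReduced_cons_cons]
      exact ⟨ne_inv_iff.1 (X.2 0), h⟩

theorem toWord_prefixElt (X : FreeBoundary N) (n : ℕ) :
    (X.prefixElt n).toWord = X.initial n := by
  rw [prefixElt, FreeGroup.toWord_mk, (isReduced_initial X n).reduce_eq]

theorem tendsto_prefixElt (X : FreeBoundary N) {u : ℕ → ℕ} (hu : Tendsto u atTop atTop) :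
    Tendsto (fun n => X.prefixElt (u n)) atTop X.endFilter := by
  refine tendsto_iInf.2 fun m => tendsto_principal.2 ?_
  filter_upwards [hu.eventually_ge_atTop m] with n hn
  rw [toWord_prefixElt]
  exact initial_prefix_initial X hn

/-- The inverse of a prefix of `X` does not cancel against an infinite word with another first
letter. -/
theorem initial_prefixElt_inv_smul {X Y : FreeBoundary N} (h : X.1 0 ≠ Y.1 0) (n : ℕ) :
    ((X.prefixElt n)⁻¹ • Y).prefixElt n = (X.prefixElt n)⁻¹ ∧
      ((X.prefixElt n)⁻¹ • Y).1 0 ≠ X.1 n := by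
  -- The second conjunct drives the induction: it says that the next letter `(X.1 n).inv` is put in
  -- front without cancellation.
  induction n with
  | zero =>
    have h1 (X : FreeBoundary N) : X.prefixElt 0 = 1 := by
      simp [prefixElt, initial, FreeGroup.one_eq_mk]
    simpa [h1] using h.symm
  | succ n ih =>
    have h1 (X : FreeBoundary N) : X.prefixElt 1 = FreeGroup.mk [X.1 0] := by
      simp [prefixElt, initial]
    have h2 : (X.prefixElt (n + 1))⁻¹ = FreeGroup.mk [(X.1 n).inv] * (X.prefixElt n)⁻¹ := by
      rw [prefixElt_add, mul_inv_rev, h1, FreeGroup.inv_mk]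
      rfl
    have h3 := ih.2
    rw [← inv_inv_letter (X.1 n)] at h3
    set Y' := (X.prefixElt n)⁻¹ • Y
    have h4 : (X.prefixElt (n + 1))⁻¹ • Y = Y'.cons (X.1 n).inv h3 := by
      rw [h2, mul_smul, mk_singleton_smul, push_of_ne h3]
    rw [h4]
    constructor
    · rw [h2, ← ih.1, prefixElt, initial_succ]
      rfl
    · exact (X.2 n).symm

end FreeBoundary

/-! ### Atoms of currents -/

section Topology

variable {N : ℕ}

theorem FreeBoundary.continuous_letter (n : ℕ) :
    @Continuous _ _ _ ⊥ (fun X : FreeBoundary N => X.1 n) := by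
  let : TopologicalSpace (Letter N) := ⊥
  exact (continuous_apply n).comp continuous_induced_dom

instance : T2Space (FreeBoundary N) := by
  let : TopologicalSpace (Letter N) := ⊥
  have : DiscreteTopology (Letter N) := ⟨rfl⟩
  exact inferInstanceAs (T2Space {X : ℕ → Letter N // ∀ n, X (n + 1) ≠ (X n).inv})

instance : CompactSpace (FreeBoundary N) := by
  let : TopologicalSpace (Letter N) := ⊥
  have : DiscreteTopology (Letter N) := ⟨rfl⟩
  have h : IsClosed {X : ℕ → Letter N | ∀ n, X (n + 1) ≠ (X n).inv} := by
    rw [Set.ofPred_forall]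
    refine isClosed_iInter fun n => ?_
    have hc : Continuous fun X : ℕ → Letter N => (X n, X (n + 1)) := by fun_prop
    exact (isClosed_discrete {p : Letter N × Letter N | p.2 ≠ p.1.inv}).preimage hc
  exact isCompact_iff_compactSpace.1 h.isCompact

namespace DoubleBoundary

instance : T2Space (DoubleBoundary N) :=
  inferInstanceAs (T2Space {p : FreeBoundary N × FreeBoundary N // p.1 ≠ p.2})

/-- The condition is closed in the compact space `∂F_N × ∂F_N` and already excludes the diagonal. -/
theorem isCompact_setOf_letter_zero_ne :
    IsCompact {Z : DoubleBoundary N | Z.1.1.1 0 ≠ Z.1.2.1 0} := by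
  let : TopologicalSpace (Letter N) := ⊥
  have : DiscreteTopology (Letter N) := ⟨rfl⟩
  have hi : @Topology.IsInducing (DoubleBoundary N) (FreeBoundary N × FreeBoundary N) _ _
    Subtype.val := ⟨rfl⟩
  refine hi.isCompact_iff.2 ?_
  have h : IsClosed {p : FreeBoundary N × FreeBoundary N | p.1.1 0 ≠ p.2.1 0} :=
    (isClosed_discrete {p : Letter N × Letter N | p.1 ≠ p.2}).preimage
      (((FreeBoundary.continuous_letter 0).comp continuous_fst).prodMk
        ((FreeBoundary.continuous_letter 0).comp continuous_snd))
  convert h.isCompact using 1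
  ext p
  constructor
  · rintro ⟨Z, hZ, rfl⟩
    exact hZ
  · intro hp
    exact ⟨⟨p, fun e => hp (by rw [e])⟩, hp, rfl⟩

theorem smul_val (g : FreeGroup (Fin N)) (Z : DoubleBoundary N) :
    (g • Z).1 = (g • Z.1.1, g • Z.1.2) := rfl

end DoubleBoundary

theorem IsCurrent.measure_smul_singleton {μ : Measure (DoubleBoundary N)} (hμ : IsCurrent μ)
    (g : FreeGroup (Fin N)) (Z : DoubleBoundary N) : μ {g • Z} = μ {Z} := by
  rw [← hμ.invariant g {g • Z} (measurableSet_singleton _)]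
  congr 1
  ext W
  simp only [Set.mem_preimage, Set.mem_singleton_iff]
  refine ⟨fun h => ?_, fun h => by rw [h]⟩
  have h' := congrArg Subtype.val h
  simp only [DoubleBoundary.smul_val, Prod.mk.injEq, smul_left_cancel_iff] at h'
  exact Subtype.ext (Prod.ext h'.1 h'.2)

/-- If a current has an atom, then it has an atom at the pair of endpoints of the axis of a
non-trivial element of `F_N`. -/
theorem IsCurrent.exists_periodic_atom {μ : Measure (DoubleBoundary N)} (hμ : IsCurrent μ)
    {Z : DoubleBoundary N} (hZ : μ {Z} ≠ 0) :
    ∃ (W : DoubleBoundary N) (v : FreeGroup (Fin N)), μ {W} ≠ 0 ∧ v ≠ 1 ∧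
      Tendsto (fun n : ℕ => v ^ n) atTop W.1.1.endFilter ∧
      Tendsto (fun n : ℕ => (v ^ n)⁻¹) atTop W.1.2.endFilter := by
  classical
  -- Otherwise strip the longest common prefix of the two words by translation; the mass is
  -- unchanged.
  wlog h0 : Z.1.1.1 0 ≠ Z.1.2.1 0 generalizing Z
  · have hex : ∃ n, Z.1.1.1 n ≠ Z.1.2.1 n := by
      by_contra! h
      exact Z.2 (Subtype.ext (funext h))
    set n := Nat.find hex
    have hn : Z.1.1.1 n ≠ Z.1.2.1 n := Nat.find_spec hex
    have hp : Z.1.1.prefixElt n = Z.1.2.prefixElt n := by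
      unfold FreeBoundary.prefixElt FreeBoundary.initial
      congr 2
      funext i
      exact not_not.1 (Nat.find_min hex i.2)
    refine this (Z := (Z.1.1.prefixElt n)⁻¹ • Z) (by rwa [hμ.measure_smul_singleton]) ?_
    rw [DoubleBoundary.smul_val, FreeBoundary.prefixElt_inv_smul]
    simp only [hp, FreeBoundary.prefixElt_inv_smul]
    exact hn
  obtain ⟨⟨X, Y⟩, hXY⟩ := Z
  simp only at h0
  set Z : DoubleBoundary N := ⟨(X, Y), hXY⟩
  have hK (n : ℕ) : (X.prefixElt n)⁻¹ • Z ∈ {Z : DoubleBoundary N | Z.1.1.1 0 ≠ Z.1.2.1 0} := by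
    rw [Set.mem_ofPred_eq, DoubleBoundary.smul_val, FreeBoundary.prefixElt_inv_smul]
    exact (FreeBoundary.initial_prefixElt_inv_smul h0 n).2.symm
  -- Infinitely many distinct atoms of equal mass would give a compact set infinite measure.
  have hninj : ¬ Function.Injective fun n : ℕ => (X.prefixElt n)⁻¹ • Z := by
    intro hinj
    have htop := (Set.infinite_range_of_injective hinj).meas_eq_top (μ := μ)
      ⟨μ {Z}, hZ, by rintro _ ⟨n, rfl⟩; exact (hμ.measure_smul_singleton _ _).ge⟩
    have := hμ.finite_on_compacts
    have hlt := (DoubleBoundary.isCompact_setOf_letter_zero_ne (N := N)).measure_lt_top (μ := μ)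
    refine (hlt.trans_le (top_le_iff.2 ?_)).ne rfl
    exact top_le_iff.1 (htop ▸ measure_mono (by rintro _ ⟨n, rfl⟩; exact hK n))
  obtain ⟨m, n, hmn, hlt⟩ : ∃ m n, (X.prefixElt m)⁻¹ • Z = (X.prefixElt n)⁻¹ • Z ∧ m < n := by
    simp only [Function.Injective, not_forall] at hninj
    obtain ⟨m, n, h, hne⟩ := hninj
    rcases lt_or_gt_of_ne hne with hl | hl
    exacts [⟨m, n, h, hl⟩, ⟨n, m, h.symm, hl⟩]
  obtain ⟨k, rfl⟩ := Nat.exists_eq_add_of_lt hlt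
  rw [add_assoc] at hmn
  have hval := congrArg Subtype.val hmn
  simp only [DoubleBoundary.smul_val, Prod.mk.injEq] at hval
  have hW0 := hK m
  set W := (X.prefixElt m)⁻¹ • Z
  have hX : W.1.1 = X.shift m := FreeBoundary.prefixElt_inv_smul m X
  -- The first coordinates of the two equal translates are `X.shift m` and `X.shift (m + (k + 1))`,
  -- so `W.1.1` is purely periodic with period word `v`; the second coordinates show that `v` fixes
  -- `W.1.2`.
  have hper : W.1.1.shift (k + 1) = W.1.1 := by
    have h : W.1.1 = X.shift (m + (k + 1)) :=
      hval.1.trans (FreeBoundary.prefixElt_inv_smul (m + (k + 1)) X)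
    refine Eq.trans ?_ h.symm
    rw [hX]
    apply Subtype.ext
    funext j
    simp [FreeBoundary.shift, add_assoc]
  set v := W.1.1.prefixElt (k + 1) with hv
  have hvY : v⁻¹ • W.1.2 = W.1.2 := by
    have h := hval.2
    rw [FreeBoundary.prefixElt_add, ← hX, ← hv, mul_inv_rev, mul_smul] at h
    exact h.symm
  have hvn (n : ℕ) : (v ^ n)⁻¹ • W.1.2 = W.1.2 := by
    induction n with
    | zero => simp
    | succ n ih => rw [pow_succ, mul_inv_rev, mul_smul, ih, hvY]
  have hpow := FreeBoundary.prefixElt_mul_of_shift_eq hper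
  have hlim : Tendsto (fun n : ℕ => (k + 1) * n) atTop atTop :=
    tendsto_id.const_mul_atTop' (Nat.succ_pos k)
  refine ⟨W, v, by rwa [hμ.measure_smul_singleton], fun h => ?_, ?_, ?_⟩
  · have := congrArg (List.length ∘ FreeGroup.toWord) h
    simp [hv, FreeBoundary.toWord_prefixElt] at this
  · exact (FreeBoundary.tendsto_prefixElt W.1.1 hlim).congr hpow
  -- Applying `v^{-n}` to `W.1.2` involves no cancellation, so the result starts with `v^{-n}`; but
  -- it is `W.1.2` itself.
  · refine (FreeBoundary.tendsto_prefixElt W.1.2 hlim).congr fun n => ?_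
    have h := (FreeBoundary.initial_prefixElt_inv_smul hW0 ((k + 1) * n)).1
    rwa [hpow, ← hv, hvn] at h

end Topology

/-! ### Fixed-point-free isometries of `ℝ`-trees -/

theorem IsRTree.exists_midpoint {T : Type*} [MetricSpace T] (hT : IsRTree T) (x y : T) :
    ∃ m, dist x m = dist x y / 2 ∧ dist m y = dist x y / 2 := by
  obtain ⟨f, h0, h1, hf⟩ := hT.geodesic x y
  have hd : 0 ≤ dist x y := dist_nonneg
  refine ⟨f (dist x y / 2), ?_, ?_⟩
  · nth_rw 1 [← h0]
    rw [hf 0 ⟨le_rfl, hd⟩ _ ⟨by linarith, by linarith⟩, zero_sub, abs_neg,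
      abs_of_nonneg (by linarith)]
  · nth_rw 2 [← h1]
    rw [hf _ ⟨by linarith, by linarith⟩ _ ⟨hd, le_rfl⟩, abs_sub_comm, abs_of_nonneg (by linarith)]
    linarith

section Axis

variable {G T : Type*} [Group G] [MetricSpace T] [MulAction G T] [IsIsometricSMul G T]

theorem dist_pow_smul_pow_smul (w : G) (x y : T) (m k : ℕ) :
    dist (w ^ m • x) (w ^ (m + k) • y) = dist x (w ^ k • y) := by
  rw [pow_add, mul_smul, dist_smul]

/-- Displacements grow linearly as soon as `d(x, wx) < d(x, w²x)`. -/
theorem IsRTree.add_mul_le_dist_pow_smul (hT : IsRTree T) (w : G) (x : T)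
    (h : dist x (w • x) < dist x (w ^ 2 • x)) (n : ℕ) :
    dist x (w • x) + n * (dist x (w ^ 2 • x) - dist x (w • x)) ≤ dist x (w ^ (n + 1) • x) := by
  set ℓ := dist x (w ^ 2 • x) - dist x (w • x) with hℓ
  have hpos : 0 < ℓ := sub_pos.2 h
  suffices H : dist x (w • x) + n * ℓ ≤ dist x (w ^ (n + 1) • x) ∧
      ℓ ≤ dist x (w ^ (n + 2) • x) - dist x (w ^ (n + 1) • x) from H.1
  induction n with
  | zero => simp [hℓ]
  | succ n ih =>
    have h1 : dist x (w • x) + (n + 1 : ℕ) * ℓ ≤ dist x (w ^ (n + 2) • x) := by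
      push_cast
      linarith [ih.1, ih.2]
    refine ⟨h1, ?_⟩
    -- With `d_k = d(x, w^k x)`, this reads `2 d_{n+2} ≤ max (2 d_1) (d_{n+3} + d_{n+1})`. Since
    -- `d_{n+2} > d_1`, the second term dominates: the increments of `d_k` do not decrease.
    have h4 := hT.zero_hyperbolic x (w ^ (n + 2) • x) (w ^ 1 • x) (w ^ (n + 3) • x)
    have e1 := dist_pow_smul_pow_smul w x x 1 (n + 2)
    have e2 := dist_pow_smul_pow_smul w x x (n + 2) 1
    have e3 := dist_pow_smul_pow_smul w x x 1 (n + 1)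
    rw [show 1 + (n + 2) = n + 3 by ring] at e1
    rw [show n + 2 + 1 = n + 3 by ring] at e2
    rw [show 1 + (n + 1) = n + 2 by ring] at e3
    rw [e1, e2, dist_comm (w ^ (n + 2) • x), e3, pow_one] at h4
    have hn : 0 < ((n + 1 : ℕ) : ℝ) * ℓ := by positivity
    change ℓ ≤ dist x (w ^ (n + 3) • x) - dist x (w ^ (n + 2) • x)
    rcases le_max_iff.1 h4 with h5 | h5 <;> linarith [ih.2]

/-- A fixed-point-free isometry of an `ℝ`-tree has an axis. -/
theorem IsRTree.exists_axis_point (hT : IsRTree T) [Nonempty T] (w : G)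
    (hw : ∀ x : T, w • x ≠ x) :
    ∃ m : T, ∀ n : ℕ, dist m (w ^ n • m) = n * dist m (w • m) := by
  obtain ⟨x⟩ := ‹Nonempty T›
  obtain ⟨m, hm1, hm2⟩ := hT.exists_midpoint x (w • x)
  have e1 : dist (w • x) (w ^ 2 • x) = dist x (w • x) := by
    rw [pow_two, mul_smul, dist_smul]
  have e2 : dist (w • x) (w • m) = dist x (w • x) / 2 := by rw [dist_smul, hm1]
  have e3 : dist (w • m) (w ^ 2 • x) = dist x (w • x) / 2 := by
    rw [pow_two, mul_smul, dist_smul, hm2]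
  -- With `d_k = d(x, w^k x)`, the two inequalities give `d(m, w m) ≤ max 0 (d_2 - d_1)`. If `d_2 ≤
  -- d_1`, the midpoint `m` is fixed. Otherwise `n d(m, w m) ≤ n (d_2 - d_1) ≤ d_{n+1} - d_1 ≤ d(m,
  -- w^n m)`.
  have h1 := hT.zero_hyperbolic m (w ^ 2 • x) x (w • x)
  have h2 := hT.zero_hyperbolic m (w • m) (w • x) (w ^ 2 • x)
  rw [dist_comm m x, hm1, hm2, dist_comm (w ^ 2 • x), e1, dist_comm (w ^ 2 • x)] at h1
  rw [e1, hm2, e3, dist_comm (w • m), e2] at h2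
  by_cases hlt : dist x (w • x) < dist x (w ^ 2 • x)
  · refine ⟨m, fun n => le_antisymm ?_ ?_⟩
    · induction n with
      | zero => simp
      | succ n ih =>
        have h3 := dist_triangle m (w ^ n • m) (w ^ (n + 1) • m)
        rw [dist_pow_smul_pow_smul w m m n 1, pow_one] at h3
        push_cast
        linarith
    · have hupper : dist m (w • m) ≤ dist x (w ^ 2 • x) - dist x (w • x) := by
        rw [max_eq_right (by linarith)] at h1
        have h3 : dist m (w ^ 2 • x) ≤ dist x (w ^ 2 • x) - dist x (w • x) / 2 := by linarith
        rcases le_max_iff.1 h2 with h | h <;> linarith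
      have hlow := hT.add_mul_le_dist_pow_smul w x hlt n
      have h3 := dist_triangle4 x m (w ^ n • m) (w ^ (n + 1) • x)
      rw [dist_pow_smul_pow_smul w m x n 1, pow_one, hm1, hm2] at h3
      have h4 := mul_le_mul_of_nonneg_left hupper (Nat.cast_nonneg (α := ℝ) n)
      linarith
  · exfalso
    push Not at hlt
    rw [max_eq_left (by linarith)] at h1
    have h3 : dist m (w • m) ≤ 0 := by
      rcases le_max_iff.1 h2 with h | h <;> linarith
    exact hw m (dist_le_zero.1 h3).symm

end Axis

/-! ### Separation by a point of the tree -/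

section Gromov

variable {M : Type*} [MetricSpace M]

theorem gromovProduct_comm (o y z : M) : gromovProduct o y z = gromovProduct o z y := by
  simp only [gromovProduct, dist_comm y z]; ring

theorem gromovProduct_le_left (o y z : M) : gromovProduct o y z ≤ dist o y := by
  unfold gromovProduct
  linarith [dist_triangle o y z]

theorem gromovProduct_le_right (o y z : M) : gromovProduct o y z ≤ dist o z := by
  rw [gromovProduct_comm]
  exact gromovProduct_le_left o z y

theorem sub_le_gromovProduct (o o' y z : M) :
    gromovProduct o' y z - dist o' o ≤ gromovProduct o y z := by
  unfold gromovProduct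
  linarith [dist_triangle o' o y, dist_triangle o' o z]

/-- A positive product at `o` means lying in the same direction at `o`; hyperbolicity makes this
relation transitive. -/
theorem gromovProduct_pos_trans
    (hM : ∀ x y z w : M, dist x y + dist z w ≤ max (dist x z + dist y w) (dist x w + dist y z))
    {o x y z : M} (hxy : 0 < gromovProduct o x y) (hyz : 0 < gromovProduct o y z) :
    0 < gromovProduct o x z := by
  unfold gromovProduct at *
  have h := hM x z o y
  rw [dist_comm x o, dist_comm z y, dist_comm z o] at h
  rcases le_max_iff.1 h with h | h <;> linarith

end Gromov

theorem IsRTree.zero_hyperbolic_completion {T : Type*} [MetricSpace T] (hT : IsRTree T)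
    (x y z w : UniformSpace.Completion T) :
    dist x y + dist z w ≤ max (dist x z + dist y w) (dist x w + dist y z) := by
  induction x, y using UniformSpace.Completion.induction_on₂ with
  | hp => exact isClosed_le (by fun_prop) (by fun_prop)
  | ih x y =>
    induction z, w using UniformSpace.Completion.induction_on₂ with
    | hp => exact isClosed_le (by fun_prop) (by fun_prop)
    | ih z w =>
      simp only [UniformSpace.Completion.dist_eq]
      exact hT.zero_hyperbolic x y z w

section Side

variable {T : Type*} [MetricSpace T]

theorem Ray.dist_eq (γ : Ray T) (s t : ℝ≥0) : dist (γ.1 s) (γ.1 t) = |(s : ℝ) - t| := by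
  rw [γ.2.dist_eq, NNReal.dist_eq]

/-- The points of `T̂` in the direction at `o` that contains `a`. -/
def sideOf (o a : UniformSpace.Completion T) : Set (Hat T) :=
  {p | match p with
    | .point y => 0 < gromovProduct o y a
    | .bdry ξ => ∃ δ : Ray T, Quotient.mk (rayAsymptotic T) δ = ξ ∧
        ∀ᶠ r : ℝ≥0 in atTop, 0 < gromovProduct o ((δ.1 r : T) : UniformSpace.Completion T) a}

/-- The product based at `γ 0` is `min r s`, and moving the base point to `o` costs at most `d(γ 0,
o)`. -/
theorem Ray.gromovProduct_pos (γ : Ray T) (o : UniformSpace.Completion T) {r s : ℝ≥0}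
    (hr : dist ((γ.1 0 : T) : UniformSpace.Completion T) o < r)
    (hs : dist ((γ.1 0 : T) : UniformSpace.Completion T) o < s) :
    0 < gromovProduct o ((γ.1 r : T) : UniformSpace.Completion T) (γ.1 s : T) := by
  refine lt_of_lt_of_le ?_ (sub_le_gromovProduct o ((γ.1 0 : T) : UniformSpace.Completion T) _ _)
  have h0 (t : ℝ≥0) : dist (γ.1 0) (γ.1 t) = t := by simp [γ.dist_eq]
  rw [gromovProduct, UniformSpace.Completion.dist_eq, UniformSpace.Completion.dist_eq,
    UniformSpace.Completion.dist_eq, h0, h0, γ.dist_eq]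
  rcases abs_cases ((r : ℝ) - s) with h | h <;> linarith

/-- If the rays stay within `C`, the product based at `γ 0` is at least `r - C`, which outgrows the
cost of moving the base point. -/
theorem Ray.eventually_gromovProduct_pos_of_asymptotic {γ δ : Ray T}
    (h : Quotient.mk (rayAsymptotic T) γ = Quotient.mk (rayAsymptotic T) δ)
    (o : UniformSpace.Completion T) :
    ∀ᶠ r : ℝ≥0 in atTop,
      0 < gromovProduct o ((γ.1 r : T) : UniformSpace.Completion T) (δ.1 r : T) := by
  obtain ⟨C, hC⟩ : ∃ C : ℝ, ∀ t, dist (γ.1 t) (δ.1 t) ≤ C := Quotient.exact h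
  have hlim : Tendsto (fun r : ℝ≥0 => (r : ℝ)) atTop atTop := NNReal.tendsto_coe_atTop.2 tendsto_id
  filter_upwards [hlim.eventually_gt_atTop
    (C + dist ((γ.1 0 : T) : UniformSpace.Completion T) o)] with r hr
  refine lt_of_lt_of_le ?_ (sub_le_gromovProduct o ((γ.1 0 : T) : UniformSpace.Completion T) _ _)
  have h0 : dist (γ.1 0) (γ.1 r) = r := by simp [γ.dist_eq]
  rw [gromovProduct, UniformSpace.Completion.dist_eq, UniformSpace.Completion.dist_eq,
    UniformSpace.Completion.dist_eq, h0]
  linarith [dist_triangle (γ.1 0) (δ.1 r) (γ.1 r), dist_comm (γ.1 r) (δ.1 r), hC r]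

theorem bdry_mem_shadow (γ : Ray T) (t : ℝ) :
    Hat.bdry (Quotient.mk (rayAsymptotic T) γ) ∈ shadow γ t := by
  refine ⟨γ, rfl, ?_⟩
  have hlim : Tendsto (fun r : ℝ≥0 => (r : ℝ)) atTop atTop := NNReal.tendsto_coe_atTop.2 tendsto_id
  filter_upwards [hlim.eventually_gt_atTop t] with r hr
  refine ⟨r, ?_⟩
  have h0 : dist (γ.1 0) (γ.1 r) = r := by simp [γ.dist_eq]
  rw [gromovProduct, dist_self, UniformSpace.Completion.dist_eq, h0]
  linarith

theorem exists_gromovProduct_pos_of_mem_completionShadow {γ : Ray T} {t : ℝ}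
    {o y : UniformSpace.Completion T} (ht : dist ((γ.1 0 : T) : UniformSpace.Completion T) o < t)
    (hy : y ∈ completionShadow γ t) :
    ∃ s : ℝ≥0, dist ((γ.1 0 : T) : UniformSpace.Completion T) o < s ∧
      0 < gromovProduct o y (γ.1 s : T) := by
  obtain ⟨s, hs⟩ := hy
  have h0 : dist (γ.1 0) (γ.1 s) = s := by simp [γ.dist_eq]
  have h1 := gromovProduct_le_right ((γ.1 0 : T) : UniformSpace.Completion T) y (γ.1 s : T)
  rw [UniformSpace.Completion.dist_eq, h0] at h1
  refine ⟨s, by linarith, ?_⟩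
  linarith [sub_le_gromovProduct o ((γ.1 0 : T) : UniformSpace.Completion T) y (γ.1 s : T)]

/-- A small shadow lies on one side of `o`. -/
theorem IsRTree.mem_sideOf_iff_of_mem_shadow (hT : IsRTree T) {γ : Ray T} {t : ℝ}
    {o : UniformSpace.Completion T} (a : UniformSpace.Completion T)
    (ht : dist ((γ.1 0 : T) : UniformSpace.Completion T) o < t) {p : Hat T} (hp : p ∈ shadow γ t) :
    p ∈ sideOf o a ↔ Hat.bdry (Quotient.mk (rayAsymptotic T) γ) ∈ sideOf o a := by
  have htr {x y z : UniformSpace.Completion T} (h1 : 0 < gromovProduct o x y)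
      (h2 : 0 < gromovProduct o y z) : 0 < gromovProduct o x z :=
    gromovProduct_pos_trans hT.zero_hyperbolic_completion h1 h2
  have hlim : Tendsto (fun r : ℝ≥0 => (r : ℝ)) atTop atTop := NNReal.tendsto_coe_atTop.2 tendsto_id
  have hev := hlim.eventually_gt_atTop (dist ((γ.1 0 : T) : UniformSpace.Completion T) o)
  -- Every completion point of the shadow lies in the same direction at `o` as the far part of `γ`.
  have hpt {y : UniformSpace.Completion T} (hy : y ∈ completionShadow γ t) {r : ℝ≥0}
      (hr : dist ((γ.1 0 : T) : UniformSpace.Completion T) o < r) :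
      0 < gromovProduct o y (γ.1 r : T) := by
    obtain ⟨s, hs, h⟩ := exists_gromovProduct_pos_of_mem_completionShadow ht hy
    exact htr h (γ.gromovProduct_pos o hs hr)
  cases p with
  | point y =>
    constructor
    · intro h
      refine ⟨γ, rfl, ?_⟩
      filter_upwards [hev] with r hr
      exact htr (by rw [gromovProduct_comm]; exact hpt hp hr) h
    · rintro ⟨δ, hδ, h⟩
      obtain ⟨r, h1, h2, h3⟩ :=
        (h.and ((Ray.eventually_gromovProduct_pos_of_asymptotic hδ o).and hev)).exists
      exact htr (htr (hpt hp h3) (by rwa [gromovProduct_comm])) h1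
  | bdry ξ =>
    obtain ⟨δ, hδ, h⟩ := hp
    constructor
    · rintro ⟨η, hη, h'⟩
      refine ⟨γ, rfl, ?_⟩
      filter_upwards [h, h', hev,
        Ray.eventually_gromovProduct_pos_of_asymptotic (hδ.trans hη.symm) o] with r h1 h2 h3 h4
      exact htr (by rw [gromovProduct_comm]; exact hpt h1 h3) (htr h4 h2)
    · rintro ⟨η, hη, h'⟩
      refine ⟨δ, hδ, ?_⟩
      filter_upwards [h, h', hev,
        Ray.eventually_gromovProduct_pos_of_asymptotic hη.symm o] with r h1 h2 h3 h4
      exact htr (hpt h1 h3) (htr h4 h2)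

theorem isOpen_point_image {U : Set (UniformSpace.Completion T)} (hU : IsOpen U) :
    IsOpen (Hat.point '' U) :=
  TopologicalSpace.isOpen_generateFrom_of_mem (Or.inl ⟨U, hU, rfl⟩)

theorem isOpen_shadow (γ : Ray T) (t : ℝ) : IsOpen (shadow γ t) :=
  TopologicalSpace.isOpen_generateFrom_of_mem (Or.inr ⟨γ, t, rfl⟩)

theorem continuous_gromovProduct_left {M : Type*} [MetricSpace M] (o a : M) :
    Continuous fun y => gromovProduct o y a := by
  unfold gromovProduct
  fun_prop

theorem IsRTree.isOpen_sideOf (hT : IsRTree T) (o a : UniformSpace.Completion T) :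
    IsOpen (sideOf o a) := by
  rw [isOpen_iff_forall_mem_open]
  rintro (y | ⟨⟨γ⟩⟩) hp
  · refine ⟨_, ?_, isOpen_point_image
      (isOpen_lt continuous_const (continuous_gromovProduct_left o a)), ⟨y, hp, rfl⟩⟩
    rintro _ ⟨z, hz, rfl⟩
    exact hz
  · exact ⟨_, fun q hq => (hT.mem_sideOf_iff_of_mem_shadow a (lt_add_one _) hq).2 hp,
      isOpen_shadow γ _, bdry_mem_shadow γ _⟩

/-- With `isOpen_sideOf`, this cuts the complement of `o` into two disjoint open sets, so a
connected component cannot meet both. Around a completion point `y ≠ o`, the points in the direction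
of `y` at `o` form a suitable neighbourhood. -/
theorem IsRTree.isOpen_compl_sideOf_diff (hT : IsRTree T) (o a : UniformSpace.Completion T) :
    IsOpen ((sideOf o a)ᶜ \ {Hat.point o}) := by
  rw [isOpen_iff_forall_mem_open]
  rintro (y | ⟨⟨γ⟩⟩) hp
  · have hne : y ≠ o := fun h => hp.2 (by rw [h]; rfl)
    have hpos : 0 < gromovProduct o y y := by
      rw [gromovProduct, dist_self]
      linarith [dist_pos.2 hne.symm]
    refine ⟨_, ?_, isOpen_point_image
      (isOpen_lt continuous_const (continuous_gromovProduct_left o y)), ⟨y, hpos, rfl⟩⟩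
    rintro _ ⟨z, hz, rfl⟩
    have hz' : 0 < gromovProduct o z y := hz
    refine ⟨fun h => hp.1 ?_, fun h => ?_⟩
    · exact gromovProduct_pos_trans hT.zero_hyperbolic_completion
        (by rwa [gromovProduct_comm]) h
    · have e : z = o := by simpa using h
      have := gromovProduct_le_left o z y
      rw [e, dist_self] at this
      rw [e] at hz'
      linarith
  · refine ⟨_, fun q hq => ⟨fun h => hp.1 ?_, ?_⟩,
      isOpen_shadow γ (dist ((γ.1 0 : T) : UniformSpace.Completion T) o + 1), bdry_mem_shadow γ _⟩
    · exact (hT.mem_sideOf_iff_of_mem_shadow a (lt_add_one _) hq).1 h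
    · rintro rfl
      obtain ⟨s, hs⟩ := hq
      linarith [gromovProduct_le_left ((γ.1 0 : T) : UniformSpace.Completion T) o (γ.1 s : T)]

/-- The two sides of `o` are unions of directions. -/
theorem IsRTree.mem_sideOf_iff_of_isDirection (hT : IsRTree T) (o a : UniformSpace.Completion T)
    {D : Set (Hat T)} (hD : IsDirection (Hat.point o) D) {p q : Hat T} (hp : p ∈ D) (hq : q ∈ D) :
    p ∈ sideOf o a → q ∈ sideOf o a := by
  obtain ⟨x, hx, rfl⟩ := hD
  intro h
  by_contra hn
  have hsub := connectedComponentIn_subset ({Hat.point o}ᶜ : Set (Hat T)) x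
  obtain ⟨z, -, hz1, hz2⟩ := isPreconnected_connectedComponentIn _ _
    (hT.isOpen_sideOf o a) (hT.isOpen_compl_sideOf_diff o a)
    (fun z hz => by
      by_cases hz' : z ∈ sideOf o a
      exacts [Or.inl hz', Or.inr ⟨hz', hsub hz⟩])
    ⟨p, hp, h⟩ ⟨q, hq, hn, hsub hq⟩
  exact hz2.1 hz1

/-- Sequences that eventually lie on different sides of `o` have no common limit other than `o` in
the observers' topology. -/
theorem IsRTree.eq_of_tendsto_of_separated (hT : IsRTree T) {o a : UniformSpace.Completion T}
    {p : Hat T} {u v : ℕ → Hat T}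
    (hu : Tendsto u atTop (@nhds (Hat T) (obsTopology T) p))
    (hv : Tendsto v atTop (@nhds (Hat T) (obsTopology T) p))
    (hus : ∀ᶠ n in atTop, u n ∈ sideOf o a) (hvs : ∀ᶠ n in atTop, v n ∉ sideOf o a) :
    p = Hat.point o := by
  by_contra hp
  -- The direction at `o` containing `p` is open in the observers' topology, so it would eventually
  -- contain both sequences.
  set D := connectedComponentIn ({Hat.point o}ᶜ : Set (Hat T)) p
  have hD : IsDirection (Hat.point o) D := ⟨p, hp, rfl⟩
  have hmem : D ∈ @nhds (Hat T) (obsTopology T) p :=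
    @IsOpen.mem_nhds (Hat T) (obsTopology T) p D
      (TopologicalSpace.isOpen_generateFrom_of_mem ⟨_, hD⟩) (mem_connectedComponentIn hp)
  obtain ⟨n, h1, h2, h3, h4⟩ :=
    ((hu.eventually_mem hmem).and ((hv.eventually_mem hmem).and (hus.and hvs))).exists
  exact h4 (hT.mem_sideOf_iff_of_isDirection o a hD h1 h2 h3)

end Side

section Limits

variable {G T : Type*} [Group G] [MetricSpace T] [MulAction G T] [IsIsometricSMul G T]

/-- Once `n d(m, w m) > d(m, P)`, `w^n P` is in the direction of `w^n m` at `m`; for `n ≥ 1` this is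
the direction of `w m`, by additivity along the axis. -/
theorem IsRTree.eventually_pow_smul_mem_sideOf (hT : IsRTree T) {w : G} {m : T}
    (hm : ∀ n : ℕ, dist m (w ^ n • m) = n * dist m (w • m)) (hne : w • m ≠ m) (P : T) :
    ∀ᶠ n : ℕ in atTop, Hat.point ((w ^ n • P : T) : UniformSpace.Completion T) ∈
      sideOf (m : UniformSpace.Completion T) ((w • m : T) : UniformSpace.Completion T) := by
  have hpos : 0 < dist m (w • m) := dist_pos.2 hne.symm
  filter_upwards [(tendsto_natCast_atTop_atTop.atTop_mul_const hpos).eventually_gt_atTop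
    (dist m P), eventually_ge_atTop 1] with n hn h1
  obtain ⟨k, rfl⟩ := Nat.exists_eq_add_of_le h1
  refine gromovProduct_pos_trans hT.zero_hyperbolic_completion
    (y := ((w ^ (1 + k) • m : T) : UniformSpace.Completion T)) ?_ ?_
  · simp only [gromovProduct, UniformSpace.Completion.dist_eq, dist_smul]
    have h2 := dist_triangle m (w ^ (1 + k) • P) (w ^ (1 + k) • m)
    rw [dist_smul, dist_comm P m] at h2
    rw [dist_comm P m]
    linarith [hm (1 + k)]
  · have h2 := dist_pow_smul_pow_smul w m m 1 k
    rw [pow_one] at h2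
    simp only [gromovProduct, UniformSpace.Completion.dist_eq]
    rw [dist_comm (w ^ (1 + k) • m), h2, hm, hm]
    push_cast
    linarith

/-- Here `w^{-n} P` follows `w^{-n} m`, and `m` lies between `w^{-n} m` and `w m`, so their product
at `m` is zero. -/
theorem IsRTree.eventually_inv_pow_smul_notMem_sideOf (hT : IsRTree T) {w : G} {m : T}
    (hm : ∀ n : ℕ, dist m (w ^ n • m) = n * dist m (w • m)) (hne : w • m ≠ m) (P : T) :
    ∀ᶠ n : ℕ in atTop, Hat.point (((w ^ n)⁻¹ • P : T) : UniformSpace.Completion T) ∉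
      sideOf (m : UniformSpace.Completion T) ((w • m : T) : UniformSpace.Completion T) := by
  have hpos : 0 < dist m (w • m) := dist_pos.2 hne.symm
  filter_upwards [(tendsto_natCast_atTop_atTop.atTop_mul_const hpos).eventually_gt_atTop
    (dist m P)] with n hn h
  have e1 : dist m ((w ^ n)⁻¹ • m) = n * dist m (w • m) := by
    rw [← dist_smul (w ^ n) m, smul_inv_smul, dist_comm, hm]
  have e2 : dist ((w ^ n)⁻¹ • m) (w • m) = (n + 1) * dist m (w • m) := by
    rw [← dist_smul (w ^ n), smul_inv_smul, ← mul_smul, ← pow_succ, hm]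
    push_cast
    rfl
  have h1 : 0 < gromovProduct (m : UniformSpace.Completion T)
      (((w ^ n)⁻¹ • m : T) : UniformSpace.Completion T)
      ((w • m : T) : UniformSpace.Completion T) := by
    refine gromovProduct_pos_trans hT.zero_hyperbolic_completion ?_ h
    simp only [gromovProduct, UniformSpace.Completion.dist_eq, dist_smul]
    have h2 := dist_triangle m ((w ^ n)⁻¹ • P) ((w ^ n)⁻¹ • m)
    rw [dist_smul, dist_comm P m] at h2
    linarith
  simp only [gromovProduct, UniformSpace.Completion.dist_eq] at h1
  rw [e1, e2] at h1
  linarith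

/-- The forward and the backward orbit of a fixed-point-free isometry have no common limit in the
observers' topology. -/
theorem IsRTree.not_tendsto_pow_smul_and_inv_pow_smul (hT : IsRTree T) {w : G}
    (hw : ∀ x : T, w • x ≠ x) (P P' : T) (p : Hat T)
    (h1 : Tendsto (fun n : ℕ => Hat.point ((w ^ n • P : T) : UniformSpace.Completion T)) atTop
      (@nhds (Hat T) (obsTopology T) p))
    (h2 : Tendsto (fun n : ℕ => Hat.point (((w ^ n)⁻¹ • P' : T) : UniformSpace.Completion T)) atTop
      (@nhds (Hat T) (obsTopology T) p)) : False := by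
  have : Nonempty T := ⟨P⟩
  obtain ⟨m, hm⟩ := hT.exists_axis_point w hw
  -- The point `w m` is on the axis too, and the common limit would have to equal both points.
  have hm' (n : ℕ) : dist (w • m) (w ^ n • w • m) = n * dist (w • m) (w • w • m) := by
    rw [dist_smul, ← hm, ← mul_smul, ← pow_succ, pow_succ', mul_smul, dist_smul]
  have key {o : T} (ho : ∀ n : ℕ, dist o (w ^ n • o) = n * dist o (w • o)) :
      p = Hat.point (o : UniformSpace.Completion T) :=
    hT.eq_of_tendsto_of_separated h1 h2 (hT.eventually_pow_smul_mem_sideOf ho (hw o) P)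
      (hT.eventually_inv_pow_smul_notMem_sideOf ho (hw o) P')
  have h := (key hm').symm.trans (key hm)
  rw [Hat.point.injEq] at h
  exact hw m (UniformSpace.Completion.coe_injective T h)

end Limits

theorem mainTheorem9 (N : ℕ) (T : Type*) [MetricSpace T] (hT : IsRTree T)
    [MulAction (FreeGroup (Fin N)) T] [IsIsometricSMul (FreeGroup (Fin N)) T]
    (hfree : ∀ (g : FreeGroup (Fin N)) (x : T), g • x = x → g = 1)
    (hmin : IsMinimalTreeAction (FreeGroup (Fin N)) T)
    (hdense : ∀ x : T, Dense (MulAction.orbit (FreeGroup (Fin N)) x))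
    (μ : MeasureTheory.Measure (DoubleBoundary N)) (hμ : IsCurrent μ)
    (hcarried : μ (dualLamination N T)ᶜ = 0) :
    ∀ Z : DoubleBoundary N, μ {Z} = 0 := by
  intro Z
  by_contra hZ
  obtain ⟨W, v, hW, hv, hX, hY⟩ := hμ.exists_periodic_atom hZ
  have hmem : W ∈ dualLamination N T := by
    by_contra h
    exact hW (measure_mono_null (Set.singleton_subset_iff.2 h) hcarried)
  obtain ⟨p, ⟨P, hP⟩, ⟨P', hP'⟩⟩ := hmem
  exact hT.not_tendsto_pow_smul_and_inv_pow_smul (fun x h => hv (hfree v x h)) P P' p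
    (hP.comp hX) (hP'.comp hY)
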